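/- Let $G=(V,E)$ be a finite simple trivially perfect graph with $n$ nodes, i.e. there are intervals $(I_v)_{v\in V}$ of the real line, forming a laminar family (if $I_u\cap I_v\neq\emptyset$, then $I_v\subseteq I_u$ or $I_u\subseteq I_v$), such that distinct nodes $u,v$ are adjacent if and only if $I_u\cap I_v\neq\emptyset$. Let $c\in\mathbb{Z}^V$ be node weights and let $\Gamma$ be the group of all automorphisms of $G$ that preserve $c$. Let $L=(\ell_1,\dots,\ell_n)$ be an ordering of $V$ (the leaders), and for $i\in[n]$ let $O_i$ be the orbit of $\ell_i$ under the pointwise stabilizer of $\{\ell_1,\dots,\ell_{i-1}\}$ in $\Gamma$. Let $S=\{(\ell_i,f): i\in[n],\ f\in O_i\setminus\{\ell_i\}\}$; the pair $(\ell_i,f)\in S$ stands for the SST cut $-x_{\ell_i}+x_f\le 0$. Suppose that $S$ is stringent: for every $i\in[n]$, if $(O_1\cup\dots\cup O_{i-1})\setminus\{\ell_1,\dots,\ell_{i-1}\}$ is non-empty, then $\ell_i$ belongs to it. Let $D=\{f\in V: \{\ell,f\}\in E \text{ for some } (\ell,f)\in S\}$ be the set of nodes removed by the deletion operation. The SST clique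 cuts are the inequalities $-x_{\ell_i}+\sum_{f\in C}x_f\le 0$ for $i\in[n]$ and cliques $C\subseteq O_i$ of $G$. Then the matrix that arises from the clique matrix of $G$ (the incidence matrix of the inclusionwise maximal cliques versus the nodes of $G$) by adding the left-hand sides of all SST clique cuts as rows and deleting the columns of all nodes in $D$ is totally unimodular. Moreover, let $P(G)$ be the convex hull of the incidence vectors of the stable sets of $G$, and let $$P(G,S)=\operatorname{conv}\{x\in\{0,1\}^V : x\in P(G),\ -x_\ell+x_f\le 0 \text{ for all } (\ell,f)\in S\}.$$ Then $P(G,S)$ is the set of all $x\in\mathbb{R}^V$ that satisfy the box constraints $0\le x_v\le 1$ for $v\in V$, the clique inequalities $\sum_{v\in C}x_v\le 1$ for all maximal cliques $C$ of $G$, all SST clique cuts, and $x_v=0$ for all $v\in D$. -/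

import Mathlib

namespace SST

/-- The group of all automorphisms of the graph `G` that preserve the node weights `c`. -/
def weightAut {V : Type*} (G : SimpleGraph V) (c : V → ℤ) : Subgroup (Equiv.Perm V) where
  carrier := {γ | (∀ u v, G.Adj (γ u) (γ v) ↔ G.Adj u v) ∧ ∀ v, c (γ v) = c v}
  mul_mem' := by
    intro a b ha hb
    exact ⟨fun u v => (ha.1 (b u) (b v)).trans (hb.1 u v),
      fun v => (ha.2 (b v)).trans (hb.2 v)⟩
  one_mem' := ⟨fun _ _ => Iff.rfl, fun _ => rfl⟩
  inv_mem' := by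
    intro a ha
    refine ⟨fun u v => ?_, fun v => ?_⟩
    · have h := ha.1 (a.symm u) (a.symm v)
      rw [Equiv.apply_symm_apply, Equiv.apply_symm_apply] at h
      exact h.symm
    · have h := ha.2 (a.symm v)
      rw [Equiv.apply_symm_apply] at h
      exact h.symm

/-- The pointwise stabilizer of the set `I` in the permutation group `Γ`. -/
def pointStab {V : Type*} (Γ : Subgroup (Equiv.Perm V)) (I : Set V) :
    Subgroup (Equiv.Perm V) :=
  Γ ⊓ fixingSubgroup (Equiv.Perm V) I

/-- `G` is trivially perfect: it is the intersection graph of a laminar family of intervals of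
the real line. -/
def IsTriviallyPerfect {V : Type*} (G : SimpleGraph V) : Prop :=
  ∃ I : V → Set ℝ,
    (∀ v, (I v).Nonempty ∧ (I v).OrdConnected) ∧
    (∀ u v, u ≠ v → (G.Adj u v ↔ (I u ∩ I v).Nonempty)) ∧
    (∀ u v, (I u ∩ I v).Nonempty → I v ⊆ I u ∨ I u ⊆ I v)

section Leaders

variable {V : Type*} [Fintype V]

/-- The orbit computed in iteration `i` of the SST algorithm for the group `Γ` and the sequence of
leaders `L 0, L 1, …`: the orbit of `L i` under the pointwise stabilizer of the earlier leaders. -/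
def leaderOrbit (Γ : Subgroup (Equiv.Perm V)) (L : Fin (Fintype.card V) ≃ V)
    (i : Fin (Fintype.card V)) : Set V :=
  MulAction.orbit (pointStab Γ (L '' Set.Iio i)) (L i)

/-- The set `S(L)` of all SST cuts, as pairs (leader, follower). -/
def cuts (Γ : Subgroup (Equiv.Perm V)) (L : Fin (Fintype.card V) ≃ V) : Set (V × V) :=
  {p | ∃ i, p.1 = L i ∧ p.2 ∈ leaderOrbit Γ L i \ {L i}}

/-- Stringency: each leader is selected among those nodes of the earlier orbits that are not yet
leaders, as long as there are any. -/
def IsStringent (Γ : Subgroup (Equiv.Perm V)) (L : Fin (Fintype.card V) ≃ V) : Prop :=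
  ∀ i, ((⋃ j ∈ Set.Iio i, leaderOrbit Γ L j) \ L '' Set.Iio i).Nonempty →
    L i ∈ (⋃ j ∈ Set.Iio i, leaderOrbit Γ L j) \ L '' Set.Iio i

end Leaders

/-- The cone of all points that satisfy the SST cuts in `S`. -/
def cutCone {V : Type*} (S : Set (V × V)) : Set (V → ℝ) :=
  {x | ∀ p ∈ S, -x p.1 + x p.2 ≤ 0}

/-- The stable set polytope `P(G)`. -/
def stablePolytope {V : Type*} (G : SimpleGraph V) : Set (V → ℝ) :=
  convexHull ℝ {x | (∀ v, x v = 0 ∨ x v = 1) ∧ ∀ u v, G.Adj u v → x u + x v ≤ 1}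

/-- The polytope `P(G,S)`. -/
def stablePolytopeCuts {V : Type*} (G : SimpleGraph V) (S : Set (V × V)) : Set (V → ℝ) :=
  convexHull ℝ {x | (∀ v, x v = 0 ∨ x v = 1) ∧ x ∈ stablePolytope G ∩ cutCone S}

/-- The nodes that are deleted by the deletion operation: followers that are adjacent to one of
their leaders. -/
def deleted {V : Type*} (G : SimpleGraph V) (S : Set (V × V)) : Set V :=
  {f | ∃ l, (l, f) ∈ S ∧ G.Adj l f}

/-- The inclusionwise maximal cliques of `G`. -/
def MaxClique {V : Type*} (G : SimpleGraph V) : Type _ :=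
  {C : Finset V // Maximal (fun D : Finset V => G.IsClique (D : Set V)) C}

/-- The SST clique cuts derivable from `S(L)`: pairs of (the position of) a leader and a clique
contained in the orbit of that leader. -/
def CliqueCut {V : Type*} [Fintype V] (G : SimpleGraph V) (Γ : Subgroup (Equiv.Perm V))
    (L : Fin (Fintype.card V) ≃ V) : Type _ :=
  {p : Fin (Fintype.card V) × Finset V //
    (p.2 : Set V) ⊆ leaderOrbit Γ L p.1 ∧ G.IsClique (p.2 : Set V)}

/-- The clique matrix of `G`. -/
def cliqueMatrix {V : Type*} [DecidableEq V] (G : SimpleGraph V) :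
    Matrix (MaxClique G) V ℤ :=
  Matrix.of fun C v => if v ∈ C.1 then 1 else 0

/-- The matrix of the left-hand sides `-x_l + ∑_{f ∈ C} x_f` of all SST clique cuts. -/
def cliqueCutMatrix {V : Type*} [Fintype V] [DecidableEq V] (G : SimpleGraph V)
    (Γ : Subgroup (Equiv.Perm V)) (L : Fin (Fintype.card V) ≃ V) :
    Matrix (CliqueCut G Γ L) V ℤ :=
  Matrix.of fun p v => -(if v = L p.1.1 then 1 else 0) + (if v ∈ p.1.2 then 1 else 0)

/-- The clique matrix of `G` extended by all SST clique cuts, restricted to the columns of the nodes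
that are not deleted. -/
def extendedMatrix {V : Type*} [Fintype V] [DecidableEq V] (G : SimpleGraph V)
    (Γ : Subgroup (Equiv.Perm V)) (L : Fin (Fintype.card V) ≃ V) :
    Matrix (MaxClique G ⊕ CliqueCut G Γ L) {v : V // v ∉ deleted G (cuts Γ L)} ℤ :=
  (Matrix.fromRows (cliqueMatrix G) (cliqueCutMatrix G Γ L)).submatrix id Subtype.val

end SST

/-! Total unimodularity follows from Ghouila-Houri's criterion: every set `T` of surviving nodes is
signed so that each row has signed sum in {-1, 0, 1}.

Order adjacent nodes by size of closed neighbourhood. By laminarity this is a rooted forest, and a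
maximal clique contains all ancestors of its members. Adjacent nodes in one orbit of the
weight-preserving group are twins; swapping them is an automorphism fixing all other nodes, so the
later leader is deleted. Hence surviving nodes of one orbit are pairwise non-adjacent, and a clique
cut keeps at most one node of its clique.

It remains to give the two ends of each surviving cut equal signs. Call a node active if it is an
end of such a cut. Stringency forces an active proper ancestor of one end to be an earlier leader
than the leader of the cut, hence fixed by the automorphism joining the ends, hence an ancestor of
both (`adj_of_isActive`). Signs alternating along active ancestors therefore agree on both ends.
Inactive nodes alternate separately with the opposite start: on a maximal clique the active signs
sum to 0 or -1, the inactive ones to 0 or 1.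

The description of P(G,S) is then Hoffman–Kruskal integrality, since the system has the right 0/1
points. -/

/-! ### Ghouila-Houri's criterion, by columns -/

theorem Matrix.isTotallyUnimodular_of_signing {m n : Type*} (A : Matrix m n ℤ)
    (h : ∀ S : Finset n, ∃ s : n → ℤ, (∀ v, s v = 1 ∨ s v = -1) ∧
      ∀ i, |∑ v ∈ S, A i v * s v| ≤ 1) :
    A.IsTotallyUnimodular := by
  classical
  suffices H : ∀ k (f : Fin k → m) (g : Fin k → n), f.Injective → g.Injective →
      |(A.submatrix f g).det| ≤ 1 by
    intro k f g hf hg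
    have := abs_le.1 (H k f g hf hg)
    have h3 : (A.submatrix f g).det = 0 ∨ (A.submatrix f g).det = 1 ∨
      (A.submatrix f g).det = -1 := by omega
    rcases h3 with h | h | h <;> rw [h]
    · exact ⟨0, rfl⟩
    · exact ⟨1, rfl⟩
    · exact ⟨-1, rfl⟩
  intro k
  induction k with
  | zero => intro f g _ _; simp
  | succ k ih =>
    intro f g hf hg
    set B := A.submatrix f g with hB
    by_cases hd : B.det = 0
    · simp [hd]
    -- The entries of this adjugate column are minors bounded by induction, and `B` maps it to `det
    -- B` times the first unit vector.
    set x : Fin (k + 1) → ℤ := fun j => B.adjugate j 0 with hx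
    have hx1 : ∀ j, |x j| ≤ 1 := by
      intro j
      have h1 := ih (f ∘ Fin.succAbove 0) (g ∘ j.succAbove)
        (hf.comp Fin.succAbove_right_injective) (hg.comp Fin.succAbove_right_injective)
      have h2 : x j = (-1) ^ ((0 : Fin (k + 1)) + j : ℕ) *
          (A.submatrix (f ∘ Fin.succAbove 0) (g ∘ j.succAbove)).det := by
        simp only [hx, Matrix.adjugate_fin_succ_eq_det_submatrix, hB, Matrix.submatrix_submatrix]
      rw [h2, abs_mul, abs_pow, abs_neg, abs_one, one_pow, one_mul]
      exact h1
    have hBx : ∀ i, ∑ j, B i j * x j = if i = 0 then B.det else 0 := by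
      intro i
      have := congrFun (congrFun (Matrix.mul_adjugate B) i) 0
      simpa [Matrix.mul_apply, Matrix.one_apply] using this
    -- Signing exactly the support of `x` gives `y` congruent to `x` modulo 2. Off row 0 the entries
    -- of `B y` are then even and at most 1 in absolute value, so zero.
    obtain ⟨s, hs, hsum⟩ := h ((Finset.univ.filter fun j => x j ≠ 0).image g)
    set y : Fin (k + 1) → ℤ := fun j => if x j ≠ 0 then s (g j) else 0 with hy
    have hBy : ∀ i, |∑ j, B i j * y j| ≤ 1 := by
      intro i
      have := hsum (f i)
      rw [Finset.sum_image (fun a _ b _ hab => hg hab), Finset.sum_filter] at this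
      convert this using 2
      refine Finset.sum_congr rfl fun j _ => ?_
      by_cases hj : x j = 0 <;> simp [hy, hj, hB]
    have hpar : ∀ j, (2 : ℤ) ∣ x j - y j := by
      intro j
      have h1 := abs_le.1 (hx1 j)
      by_cases hj : x j = 0
      · simp [hy, hj]
      · have : y j = s (g j) := by simp [hy, hj]
        rw [this]
        rcases hs (g j) with h | h <;> rw [h] <;> omega
    have hBy0 : ∀ i, i ≠ 0 → ∑ j, B i j * y j = 0 := by
      intro i hi
      have h1 : (2 : ℤ) ∣ ∑ j, B i j * x j - ∑ j, B i j * y j := by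
        rw [← Finset.sum_sub_distrib]
        refine Finset.dvd_sum fun j _ => ?_
        rw [← mul_sub]
        exact (hpar j).mul_left _
      rw [hBx i, if_neg hi] at h1
      have := abs_le.1 (hBy i)
      omega
    obtain ⟨j, hj⟩ : ∃ j, x j ≠ 0 := by
      by_contra! hall
      have := hBx 0
      simp [hall] at this
      exact hd this.symm
    -- Apply the adjugate to `B y`, a multiple of the first unit vector. On the support of `x` this
    -- bounds the determinant, as `y j` is a sign.
    have hkey : B.det * y j = (∑ l, B 0 l * y l) * x j := by
      have h1 : (B.adjugate * B).mulVec y j = B.det * y j := by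
        simp [Matrix.adjugate_mul]
      rw [← h1, ← Matrix.mulVec_mulVec]
      have h2 : B.mulVec y = Pi.single 0 (∑ l, B 0 l * y l) := by
        funext i
        by_cases hi : i = 0
        · subst hi; simp [Matrix.mulVec, dotProduct]
        · simp [hi, Matrix.mulVec, dotProduct, hBy0 i hi]
      rw [h2]
      simp [hx, mul_comm]
    have hy1 : |y j| = 1 := by
      have : y j = s (g j) := by simp [hy, hj]
      rw [this]
      rcases hs (g j) with h | h <;> rw [h] <;> rfl
    have := congrArg abs hkey
    rw [abs_mul, abs_mul, hy1, mul_one] at this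
    rw [this]
    exact mul_le_one₀ (hBy 0) (abs_nonneg _) (hx1 j)

/-! ### Integrality of polytopes with totally unimodular constraints -/

/-- A functional vanishing on all rows is a kernel vector, hence zero; so the rows span and contain
a basis. -/
theorem Matrix.exists_det_submatrix_ne_zero {ι F : Type*} [Fintype F] [DecidableEq F]
    (A : Matrix ι F ℝ) (hA : ∀ d : F → ℝ, (∀ i, ∑ v, A i v * d v = 0) → d = 0) :
    ∃ f : F → ι, Function.Injective f ∧ (A.submatrix f id).det ≠ 0 := by
  obtain ⟨κ, a, ha, hspan, hli⟩ := exists_linearIndependent' ℝ A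
  have htop : Submodule.span ℝ (Set.range A) = ⊤ := by
    by_contra hne
    obtain ⟨φ, hφ, hle⟩ := Submodule.exists_le_ker_of_lt_top _ (lt_top_iff_ne_top.2 hne)
    apply hφ
    have hd : (fun v => φ (Pi.single v 1)) = 0 := by
      apply hA
      intro i
      have h1 : φ (A i) = 0 := hle (Submodule.subset_span ⟨i, rfl⟩)
      rw [LinearMap.pi_apply_eq_sum_univ φ (A i)] at h1
      rw [← h1]
      refine Finset.sum_congr rfl fun v _ => ?_
      rw [smul_eq_mul]
      congr 2
      funext j
      simp [Pi.single_apply, eq_comm]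
    refine LinearMap.pi_ext' fun v => LinearMap.ext_ring ?_
    simpa using congrFun hd v
  let bas : Module.Basis κ ℝ (F → ℝ) := Module.Basis.mk hli (by rw [hspan, htop])
  let e : F ≃ κ := (Pi.basisFun ℝ F).indexEquiv bas
  refine ⟨a ∘ e, ha.comp e.injective, ?_⟩
  have hli' : LinearIndependent ℝ (A.submatrix (a ∘ e) id).row :=
    hli.comp e e.injective
  have := Matrix.linearIndependent_rows_iff_isUnit.1 hli'
  exact ((Matrix.isUnit_iff_isUnit_det _).1 this).ne_zero

section TU
variable {ι V : Type*} [Finite ι] [Fintype V]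

/-- The part of the unit cube cut out by `A x ≤ b` and by fixing the coordinates in `D` to zero. -/
def cubePolytope (A : Matrix ι V ℤ) (b : ι → ℤ) (D : Set V) : Set (V → ℝ) :=
  {x | (∀ v, 0 ≤ x v ∧ x v ≤ 1) ∧ (∀ i, ∑ v, (A i v : ℝ) * x v ≤ b i) ∧ ∀ v ∈ D, x v = 0}

/-- The fractional coordinates of an extreme point are determined by the tight rows. A nonsingular
square subsystem has determinant ±1, so it has an integral solution, which is impossible strictly
between 0 and 1. -/
theorem extremePoints_cubePolytope (A : Matrix ι V ℤ) (b : ι → ℤ) (D : Set V)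
    (hA : (A.submatrix id (Subtype.val : {v // v ∉ D} → V)).IsTotallyUnimodular)
    {x : V → ℝ} (hx : x ∈ (cubePolytope A b D).extremePoints ℝ) (v : V) : x v = 0 ∨ x v = 1 := by
  classical
  obtain ⟨⟨hbox, hrow, hD⟩, hext⟩ := hx
  let F := {v : V // x v ≠ 0 ∧ x v ≠ 1}
  have hFD : ∀ w : F, w.1 ∉ D := fun w hw => w.2.1 (hD _ hw)
  let T := {i : ι // ∑ v, (A i v : ℝ) * x v = b i}
  let M : Matrix T F ℤ := Matrix.of fun i w => A i.1 w.1
  have hsumF : ∀ (i : ι) (d : V → ℝ), (∀ v, x v = 0 ∨ x v = 1 → d v = 0) →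
      ∑ v, (A i v : ℝ) * d v = ∑ w : F, (A i w.1 : ℝ) * d w.1 := by
    intro i d hd
    rw [← Finset.sum_subtype (Finset.univ.filter fun v => x v ≠ 0 ∧ x v ≠ 1) (by simp)
      (fun v => (A i v : ℝ) * d v)]
    refine (Finset.sum_subset (Finset.filter_subset _ _) fun v _ hv => ?_).symm
    rw [hd v (by simp at hv; tauto), mul_zero]
  -- A kernel vector, extended by zero, is a direction in which the point can move slightly both
  -- ways; extremality forces it to vanish.
  have hinj : ∀ d : F → ℝ, (∀ i, ∑ w, (M.map (Int.cast : ℤ → ℝ)) i w * d w = 0) → d = 0 := by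
    intro d hd
    let e : V → ℝ := fun v => if h : x v ≠ 0 ∧ x v ≠ 1 then d ⟨v, h⟩ else 0
    have he : ∀ v, x v = 0 ∨ x v = 1 → e v = 0 := by
      intro v hv
      exact dif_neg (by tauto)
    have heF : ∀ w : F, e w.1 = d w := fun w => dif_pos w.2
    have hnear : ∀ᶠ ε : ℝ in nhds 0, x + ε • e ∈ cubePolytope A b D := by
      have hb : ∀ᶠ ε : ℝ in nhds 0, ∀ v, 0 ≤ x v + ε * e v ∧ x v + ε * e v ≤ 1 := by
        rw [Filter.eventually_all]
        intro v
        by_cases hv : x v = 0 ∨ x v = 1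
        · simp [he v hv, hbox v]
        · push Not at hv
          have hc : Filter.Tendsto (fun ε : ℝ => x v + ε * e v) (nhds 0) (nhds (x v)) := by
            have : Continuous fun ε : ℝ => x v + ε * e v := by fun_prop
            simpa using this.tendsto 0
          have h0 : 0 < x v := lt_of_le_of_ne (hbox v).1 (Ne.symm hv.1)
          have h1 : x v < 1 := lt_of_le_of_ne (hbox v).2 hv.2
          filter_upwards [hc.eventually (lt_mem_nhds h0), hc.eventually (gt_mem_nhds h1)]
            with ε h2 h3 using ⟨h2.le, h3.le⟩
      have hr : ∀ᶠ ε : ℝ in nhds 0, ∀ i, ∑ v, (A i v : ℝ) * (x v + ε * e v) ≤ b i := by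
        rw [Filter.eventually_all]
        intro i
        by_cases hi : ∑ v, (A i v : ℝ) * x v = b i
        · have h0 : ∑ v, (A i v : ℝ) * e v = 0 := by
            rw [hsumF i e he]
            simpa [heF, M] using hd ⟨i, hi⟩
          refine Filter.Eventually.of_forall fun ε => ?_
          have : ∑ v, (A i v : ℝ) * (x v + ε * e v) =
              ∑ v, (A i v : ℝ) * x v + ε * ∑ v, (A i v : ℝ) * e v := by
            rw [Finset.mul_sum, ← Finset.sum_add_distrib]
            exact Finset.sum_congr rfl fun v _ => by ring
          rw [this, h0, hi]
          simp
        · have hlt := lt_of_le_of_ne (hrow i) hi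
          have hc : Filter.Tendsto (fun ε : ℝ => ∑ v, (A i v : ℝ) * (x v + ε * e v)) (nhds 0)
              (nhds (∑ v, (A i v : ℝ) * x v)) := by
            have : Continuous fun ε : ℝ => ∑ v, (A i v : ℝ) * (x v + ε * e v) := by fun_prop
            simpa using this.tendsto 0
          filter_upwards [hc.eventually (gt_mem_nhds hlt)] with ε h2 using h2.le
      filter_upwards [hb, hr] with ε h1 h2
      refine ⟨h1, h2, fun v hv => ?_⟩
      have : e v = 0 := he v (Or.inl (hD v hv))
      simp [this, hD v hv]
    obtain ⟨ε, hε, hball⟩ := Metric.eventually_nhds_iff.1 hnear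
    have hp := hball (y := ε / 2) (by simp [abs_of_pos hε]; linarith)
    have hm := hball (y := -(ε / 2)) (by simp [abs_of_pos hε]; linarith)
    have hmem : x ∈ openSegment ℝ (x + (ε / 2) • e) (x + (-(ε / 2)) • e) := by
      refine ⟨1 / 2, 1 / 2, by norm_num, by norm_num, by norm_num, ?_⟩
      funext v
      simp
      ring
    have heq := hext hp hm hmem
    funext w
    have := congrFun heq w.1
    simp [heF] at this
    rcases this with h | h
    · exact absurd h hε.ne'
    · exact h
  obtain ⟨f, hf, hdet⟩ := Matrix.exists_det_submatrix_ne_zero _ hinj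
  let B : Matrix F F ℤ := M.submatrix f id
  have hBdet : IsUnit B.det := by
    have h1 : B.det ∈ Set.range SignType.cast :=
      (Matrix.isTotallyUnimodular_iff_fintype _).1 hA F (fun w => (f w).1)
        (fun w => ⟨w.1, hFD w⟩)
    have h2 : B.det ≠ 0 := by
      intro h0
      apply hdet
      have := Int.cast_det (R := ℝ) B
      rw [h0] at this
      simp only [Int.cast_zero] at this
      exact this.symm
    obtain ⟨s, hs⟩ := h1
    rcases s with _ | _ | _
    · exact absurd hs.symm h2
    · rw [← hs]; exact isUnit_one.neg
    · rw [← hs]; exact isUnit_one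
  have hint : ∀ w : F, ∃ z : ℤ, x w.1 = z := by
    -- The right-hand side after the coordinates equal to 1 have been moved across.
    let q : F → ℤ := fun w => b (f w).1 - ∑ v, A (f w).1 v * (if x v = 1 then 1 else 0)
    have hq : (B.map (Int.cast : ℤ → ℝ)).mulVec (fun w => x w.1) = fun w => (q w : ℝ) := by
      funext w
      have h1 := hsumF (f w).1 (fun v => x v - if x v = 1 then 1 else 0) (by
        rintro v (h | h) <;> simp [h])
      have h2 : ∀ u : F, x u.1 ≠ 1 := fun u => u.2.2
      simp only [h2, if_false, sub_zero, mul_sub, Finset.sum_sub_distrib, (f w).2] at h1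
      simp only [Matrix.mulVec, dotProduct, q, B, M, Matrix.map_apply, Matrix.submatrix_apply,
        Matrix.of_apply, id]
      rw [← h1]
      push_cast
      rfl
    have hinv : (B⁻¹.map (Int.cast : ℤ → ℝ)) * (B.map (Int.cast : ℤ → ℝ)) = 1 := by
      have := Matrix.map_mul (L := B⁻¹) (M := B) (f := Int.castRingHom ℝ)
      rw [Matrix.nonsing_inv_mul B hBdet] at this
      simpa using this.symm
    intro w
    refine ⟨(B⁻¹.mulVec q) w, ?_⟩
    have h3 := congrArg (B⁻¹.map (Int.cast : ℤ → ℝ)).mulVec hq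
    rw [Matrix.mulVec_mulVec, hinv, Matrix.one_mulVec] at h3
    have := congrFun h3 w
    rw [this]
    simp [Matrix.mulVec, dotProduct]
  by_contra hv
  push Not at hv
  obtain ⟨z, hz⟩ := hint ⟨v, hv⟩
  simp only at hz
  have h0 : (0 : ℝ) < z := hz ▸ lt_of_le_of_ne (hbox v).1 (Ne.symm hv.1)
  have h1 : (z : ℝ) < 1 := hz ▸ lt_of_le_of_ne (hbox v).2 hv.2
  have h0' : 0 < z := by exact_mod_cast h0
  have h1' : z < 1 := by exact_mod_cast h1
  omega

theorem convexHull_cubePolytope (A : Matrix ι V ℤ) (b : ι → ℤ) (D : Set V)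
    (hA : (A.submatrix id (Subtype.val : {v // v ∉ D} → V)).IsTotallyUnimodular) :
    convexHull ℝ {x | (∀ v, x v = 0 ∨ x v = 1) ∧ x ∈ cubePolytope A b D} =
      cubePolytope A b D := by
  have hfin : {x : V → ℝ | (∀ v, x v = 0 ∨ x v = 1) ∧ x ∈ cubePolytope A b D}.Finite := by
    refine (Set.Finite.pi' (t := fun _ : V => ({0, 1} : Set ℝ)) fun _ => by simp).subset ?_
    intro x hx v
    simpa using hx.1 v
  have hrows : cubePolytope A b D = Set.Icc 0 1 ∩ ((⋂ i, {x | ∑ v, (A i v : ℝ) * x v ≤ b i}) ∩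
      ⋂ v ∈ D, {x | x v = 0}) := by
    ext x
    simp [cubePolytope, Pi.le_def, forall_and]
  have hcomp : IsCompact (cubePolytope A b D) := by
    rw [hrows]
    refine isCompact_Icc.inter_right (IsClosed.inter (isClosed_iInter fun i => ?_)
      (isClosed_biInter fun v _ => ?_))
    · exact isClosed_le (by fun_prop) (by fun_prop)
    · exact isClosed_eq (by fun_prop) (by fun_prop)
  have hconv : Convex ℝ (cubePolytope A b D) := by
    rw [hrows]
    refine (convex_Icc _ _).inter (Convex.inter (convex_iInter fun i => ?_)
      (convex_iInter₂ fun v _ => ?_))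
    · refine convex_halfSpace_le (f := fun x : V → ℝ => ∑ v, (A i v : ℝ) * x v) ⟨?_, ?_⟩ _
      · intro x y; simp [mul_add, Finset.sum_add_distrib]
      · intro r x; simp [Finset.mul_sum, mul_left_comm]
    · exact convex_hyperplane (f := fun x : V → ℝ => x v) ⟨fun _ _ => rfl, fun _ _ => rfl⟩ _
  refine (convexHull_min (fun x hx => hx.2) hconv).antisymm ?_
  -- Krein–Milman; the hull of finitely many 0/1 points is already closed.
  exact (closure_convexHull_extremePoints hcomp hconv).ge.trans <| closure_minimal
    (convexHull_mono fun x hx => ⟨extremePoints_cubePolytope A b D hA hx, hx.1⟩)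
    (hfin.isClosed_convexHull ℝ)

end TU

/-! ### Neighbourhoods, orbits and deletion in trivially perfect graphs -/

namespace SST

variable {V : Type*}

/-- The closed neighbourhood of a node. -/
def closedNbhd (G : SimpleGraph V) (v : V) : Set V := {z | z = v ∨ G.Adj v z}

/-- The intervals of adjacent nodes are nested, and a larger interval meets more. If they nest the
other way, the cardinalities force equality. -/
theorem closedNbhd_subset [Finite V] {G : SimpleGraph V} (hG : IsTriviallyPerfect G) {u v : V}
    (huv : G.Adj u v) (hc : (closedNbhd G v).ncard ≤ (closedNbhd G u).ncard) :
    closedNbhd G v ⊆ closedNbhd G u := by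
  obtain ⟨I, hI, hadj, hlam⟩ := hG
  have hmem : ∀ a z, z ∈ closedNbhd G a ↔ (I a ∩ I z).Nonempty := by
    intro a z
    by_cases h : z = a
    · subst h; simp [closedNbhd, (hI z).1]
    · simp [closedNbhd, h, hadj a z (Ne.symm h)]
  have hsub : ∀ a b, I b ⊆ I a → closedNbhd G b ⊆ closedNbhd G a := by
    intro a b hab z hz
    rw [hmem] at hz ⊢
    exact hz.mono (Set.inter_subset_inter_left _ hab)
  rcases hlam u v ((hadj u v huv.ne).1 huv) with h | h
  · exact hsub u v h
  · exact (Set.eq_of_subset_of_ncard_le (hsub v u h) hc (Set.toFinite _)).ge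

theorem ncard_closedNbhd_apply {G : SimpleGraph V} {c : V → ℤ} {γ : Equiv.Perm V}
    (hγ : γ ∈ weightAut G c) (v : V) :
    (closedNbhd G (γ v)).ncard = (closedNbhd G v).ncard := by
  have : closedNbhd G (γ v) = γ '' closedNbhd G v := by
    ext z
    obtain ⟨y, rfl⟩ := γ.surjective z
    simp [closedNbhd, hγ.1]
  rw [this, Set.ncard_image_of_injective _ γ.injective]

/-- Two nodes are related if some automorphism preserving the weights maps one to the other. -/
def SameOrbit (G : SimpleGraph V) (c : V → ℤ) (u v : V) : Prop :=
  ∃ γ ∈ weightAut G c, γ u = v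

theorem SameOrbit.symm {G : SimpleGraph V} {c : V → ℤ} {u v : V} (h : SameOrbit G c u v) :
    SameOrbit G c v u := by
  obtain ⟨γ, hγ, rfl⟩ := h
  exact ⟨γ⁻¹, inv_mem hγ, by simp⟩

theorem SameOrbit.trans {G : SimpleGraph V} {c : V → ℤ} {u v w : V} (h : SameOrbit G c u v)
    (h' : SameOrbit G c v w) : SameOrbit G c u w := by
  obtain ⟨γ, hγ, rfl⟩ := h
  obtain ⟨δ, hδ, rfl⟩ := h'
  exact ⟨δ * γ, mul_mem hδ hγ, rfl⟩

variable [Fintype V]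

theorem mem_leaderOrbit {Γ : Subgroup (Equiv.Perm V)} {L : Fin (Fintype.card V) ≃ V}
    {i : Fin (Fintype.card V)} {f : V} :
    f ∈ leaderOrbit Γ L i ↔ ∃ γ ∈ Γ, (∀ j < i, γ (L j) = L j) ∧ γ (L i) = f := by
  constructor
  · rintro ⟨⟨γ, hγ, hfix⟩, h⟩
    exact ⟨γ, hγ, fun j hj => (mem_fixingSubgroup_iff _).1 hfix _ ⟨j, hj, rfl⟩, h⟩
  · rintro ⟨γ, hγ, hfix, h⟩
    refine ⟨⟨γ, hγ, (mem_fixingSubgroup_iff _).2 ?_⟩, h⟩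
    rintro _ ⟨j, hj, rfl⟩
    exact hfix j hj

section Setup

variable {G : SimpleGraph V} {c : V → ℤ} {L : Fin (Fintype.card V) ≃ V}

theorem sameOrbit_of_mem_leaderOrbit {i : Fin (Fintype.card V)} {f : V}
    (h : f ∈ leaderOrbit (weightAut G c) L i) : SameOrbit G c (L i) f := by
  obtain ⟨γ, hγ, -, h⟩ := mem_leaderOrbit.1 h
  exact ⟨γ, hγ, h⟩

theorem self_mem_leaderOrbit (i : Fin (Fintype.card V)) :
    L i ∈ leaderOrbit (weightAut G c) L i :=
  mem_leaderOrbit.2 ⟨1, one_mem _, fun _ _ => rfl, rfl⟩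

/-- Equal degrees make the adjacent nodes twins, so their transposition is a weight-preserving
automorphism fixing all leaders before `a`. -/
theorem mem_deleted_of_lt (hG : IsTriviallyPerfect G) {a b : Fin (Fintype.card V)} (hab : a < b)
    (ho : SameOrbit G c (L a) (L b)) (hadj : G.Adj (L a) (L b)) :
    L b ∈ deleted G (cuts (weightAut G c) L) := by
  classical
  refine ⟨L a, ⟨a, rfl, ?_, hadj.ne'⟩, hadj⟩
  obtain ⟨γ, hγ, hγab⟩ := ho
  have hcard : (closedNbhd G (L b)).ncard = (closedNbhd G (L a)).ncard := by
    rw [← hγab, ncard_closedNbhd_apply hγ]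
  have hN : closedNbhd G (L a) = closedNbhd G (L b) :=
    (closedNbhd_subset hG hadj.symm hcard.ge).antisymm (closedNbhd_subset hG hadj hcard.le)
  have htwin : ∀ z, z ≠ L a → z ≠ L b → (G.Adj (L a) z ↔ G.Adj (L b) z) := by
    intro z h1 h2
    have := Set.ext_iff.1 hN z
    simpa [closedNbhd, h1, h2] using this
  have hcw : c (L b) = c (L a) := by rw [← hγab]; exact hγ.2 _
  refine mem_leaderOrbit.2 ⟨Equiv.swap (L a) (L b), ⟨fun u v => ?_, fun v => ?_⟩, ?_, ?_⟩
  · simp only [Equiv.swap_apply_def]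
    have h1 := htwin u
    have h2 := htwin v
    have h3 := G.adj_comm
    split_ifs <;> simp_all [G.adj_comm]
  · simp only [Equiv.swap_apply_def]
    split_ifs <;> simp_all
  · intro j hj
    exact Equiv.swap_apply_of_ne_of_ne (L.injective.ne hj.ne) (L.injective.ne (hj.trans hab).ne)
  · exact Equiv.swap_apply_left _ _

theorem not_sameOrbit_of_adj (hG : IsTriviallyPerfect G) {u v : V}
    (hu : u ∉ deleted G (cuts (weightAut G c) L)) (hv : v ∉ deleted G (cuts (weightAut G c) L))
    (hadj : G.Adj u v) : ¬ SameOrbit G c u v := by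
  intro ho
  obtain ⟨a, rfl⟩ := L.surjective u
  obtain ⟨b, rfl⟩ := L.surjective v
  rcases lt_trichotomy a b with h | h | h
  · exact hv (mem_deleted_of_lt hG h ho hadj)
  · exact hadj.ne (congrArg L h)
  · exact hu (mem_deleted_of_lt hG h ho.symm hadj.symm)

/-- Under stringency, the followers left over at any time lie in a single orbit of the full group,
and the next leader is taken from them. -/
theorem sameOrbit_of_isStringent (hL : IsStringent (weightAut G c) L)
    {a t s : Fin (Fintype.card V)} (hat : a < t) (hts : t ≤ s)
    (hs : L s ∈ leaderOrbit (weightAut G c) L a) : SameOrbit G c (L t) (L s) := by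
  -- Stated for pairs of leftovers so that induction applies: a leftover at `t + 1` was a leftover
  -- at `t`, as was the leader chosen there, or lies in that leader's own orbit.
  have key : ∀ (t : ℕ) (x y : V),
      (∃ i : Fin (Fintype.card V), i.1 < t ∧ x ∈ leaderOrbit (weightAut G c) L i) →
      t ≤ (L.symm x).1 →
      (∃ i : Fin (Fintype.card V), i.1 < t ∧ y ∈ leaderOrbit (weightAut G c) L i) →
      t ≤ (L.symm y).1 → SameOrbit G c x y := by
    intro t
    induction t with
    | zero => rintro x y ⟨i, hi, -⟩; omega
    | succ t ih =>
      rintro x y ⟨i, hi, hxi⟩ hx ⟨j, hj, hyj⟩ hy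
      have ht : t < Fintype.card V := lt_of_lt_of_le (Nat.lt_of_succ_le hx) (Fin.is_lt _).le
      -- a follower that is left over from before `t` lies in the orbit of the leader at `t`
      have hlead : ∀ z, (∃ i : Fin (Fintype.card V), i.1 < t ∧
          z ∈ leaderOrbit (weightAut G c) L i) → t ≤ (L.symm z).1 →
          SameOrbit G c (L ⟨t, ht⟩) z := by
        rintro z ⟨i, hi, hz⟩ htz
        have hmem := hL ⟨t, ht⟩ ⟨z, by
          simp only [Set.mem_iUnion]
          exact ⟨i, hi, hz⟩, by
          rintro ⟨k, hk, rfl⟩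
          simp only [Equiv.symm_apply_apply] at htz
          exact absurd (show k.1 < t from hk) (by omega)⟩
        obtain ⟨h1, -⟩ := hmem
        simp only [Set.mem_iUnion] at h1
        obtain ⟨k, hk, hk'⟩ := h1
        exact ih _ _ ⟨k, hk, hk'⟩ (by simp) ⟨i, hi, hz⟩ htz
      have hall : ∀ z, (∃ i : Fin (Fintype.card V), i.1 < t + 1 ∧
          z ∈ leaderOrbit (weightAut G c) L i) → t + 1 ≤ (L.symm z).1 →
          SameOrbit G c (L ⟨t, ht⟩) z := by
        rintro z ⟨i, hi, hz⟩ htz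
        rcases Nat.lt_succ_iff_lt_or_eq.1 hi with h | h
        · exact hlead z ⟨i, h, hz⟩ (by omega)
        · have : i = ⟨t, ht⟩ := Fin.ext h
          subst this
          exact sameOrbit_of_mem_leaderOrbit hz
      exact (hall x ⟨i, hi, hxi⟩ hx).symm.trans (hall y ⟨j, hj, hyj⟩ hy)
  have hmem := hL t ⟨L s, by
    simp only [Set.mem_iUnion]
    exact ⟨a, hat, hs⟩, by
    rintro ⟨k, hk, h⟩
    rw [L.injective h] at hk
    exact absurd hk (not_lt.2 hts)⟩
  obtain ⟨h1, -⟩ := hmem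
  simp only [Set.mem_iUnion] at h1
  obtain ⟨k, hk, hk'⟩ := h1
  exact key t _ _ ⟨k, hk, hk'⟩ (by simp) ⟨a, hat, hs⟩ (by simpa using hts)

/-- The nodes that occur in an SST cut between two nodes that are not deleted. -/
def IsActive (G : SimpleGraph V) (c : V → ℤ) (L : Fin (Fintype.card V) ≃ V) (w : V) : Prop :=
  ∃ j u, L j ∉ deleted G (cuts (weightAut G c) L) ∧ u ∉ deleted G (cuts (weightAut G c) L) ∧
    u ∈ leaderOrbit (weightAut G c) L j ∧ u ≠ L j ∧ (w = L j ∨ w = u)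

/-- An active node that dominates one end of a surviving cut is an earlier leader than the leader
of that cut. -/
theorem symm_lt_of_isActive (hG : IsTriviallyPerfect G) (hL : IsStringent (weightAut G c) L)
    {i : Fin (Fintype.card V)} {f w x : V} (hi : L i ∉ deleted G (cuts (weightAut G c) L))
    (hf : f ∉ deleted G (cuts (weightAut G c) L)) (hif : f ∈ leaderOrbit (weightAut G c) L i)
    (hx : x = L i ∨ x = f) (hw : IsActive G c L w) (hadj : G.Adj w x)
    (hdeg : (closedNbhd G x).ncard ≤ (closedNbhd G w).ncard) : L.symm w < i := by
  obtain ⟨j, u, hj, hu, hju, hne, hwu⟩ := hw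
  by_contra! hiw
  have hxD : x ∉ deleted G (cuts (weightAut G c) L) := by rcases hx with rfl | rfl <;> assumption
  have hwD : w ∉ deleted G (cuts (weightAut G c) L) := by rcases hwu with rfl | rfl <;> assumption
  have hno : ¬ SameOrbit G c w x := not_sameOrbit_of_adj hG hwD hxD hadj
  have hwO : w ∈ leaderOrbit (weightAut G c) L j := by
    rcases hwu with rfl | rfl
    · exact self_mem_leaderOrbit _
    · exact hju
  have hxO : x ∈ leaderOrbit (weightAut G c) L i := by
    rcases hx with rfl | rfl
    · exact self_mem_leaderOrbit _
    · exact hif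
  -- Otherwise `x` is a leader before `j`, so the automorphism behind the cut of `w` fixes it.
  have hjx : j ≤ L.symm x := by
    by_contra! hlt
    obtain ⟨δ, hδ, hfix, hδu⟩ := mem_leaderOrbit.1 hju
    have hδx : δ x = x := by simpa using hfix _ hlt
    have hNx := closedNbhd_subset hG hadj hdeg
    -- both ends of the cut of `w` are adjacent to `x`, hence to each other
    have hux : G.Adj (L j) x ∧ G.Adj u x := by
      rcases hwu with rfl | rfl
      · refine ⟨hadj, ?_⟩
        have := (hδ.1 (L j) x).2 hadj
        rwa [hδx, hδu] at this
      · refine ⟨(hδ.1 (L j) x).1 ?_, hadj⟩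
        rwa [hδx, hδu]
    have hcut : G.Adj (L j) u := by
      rcases hwu with rfl | rfl
      · have : u ∈ closedNbhd G (L j) := hNx (Or.inr hux.2.symm)
        exact this.resolve_left hne
      · have : L j ∈ closedNbhd G w := hNx (Or.inr hux.1.symm)
        exact (this.resolve_left hne.symm).symm
    exact not_sameOrbit_of_adj hG hj hu hcut (sameOrbit_of_mem_leaderOrbit hju)
  -- Whichever of `x`, `w` leads first does so while the other is a leftover, or is itself the
  -- leader of the other's orbit. Either way they share an orbit, contradicting `hno`.
  have hxw : L.symm x ≠ L.symm w := fun h => hadj.ne' (L.symm.injective h)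
  rcases lt_or_gt_of_ne hxw with hlt | hlt
  · -- `x` comes first
    rcases hjx.lt_or_eq with h | h
    · have := sameOrbit_of_isStringent hL (s := L.symm w) h hlt.le (by simpa using hwO)
      simp only [Equiv.apply_symm_apply] at this
      exact hno this.symm
    · apply hno
      have := sameOrbit_of_mem_leaderOrbit hwO
      rw [h, Equiv.apply_symm_apply] at this
      exact this.symm
  · rcases hiw.lt_or_eq with h | h
    · have := sameOrbit_of_isStringent hL (s := L.symm x) h hlt.le (by simpa using hxO)
      simp only [Equiv.apply_symm_apply] at this
      exact hno this
    · apply hno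
      have := sameOrbit_of_mem_leaderOrbit hxO
      rwa [h, Equiv.apply_symm_apply] at this

/-- An active node that dominates one end of a surviving cut strictly dominates both. -/
theorem adj_of_isActive (hG : IsTriviallyPerfect G) (hL : IsStringent (weightAut G c) L)
    {i : Fin (Fintype.card V)} {f w : V} (hi : L i ∉ deleted G (cuts (weightAut G c) L))
    (hf : f ∉ deleted G (cuts (weightAut G c) L)) (hif : f ∈ leaderOrbit (weightAut G c) L i)
    (hne : f ≠ L i) (hw : IsActive G c L w)
    (h : G.Adj w (L i) ∧ (closedNbhd G (L i)).ncard ≤ (closedNbhd G w).ncard ∨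
      G.Adj w f ∧ (closedNbhd G f).ncard ≤ (closedNbhd G w).ncard) :
    (G.Adj w (L i) ∧ (closedNbhd G (L i)).ncard < (closedNbhd G w).ncard) ∧
      G.Adj w f ∧ (closedNbhd G f).ncard < (closedNbhd G w).ncard := by
  obtain ⟨γ, hγ, hfix, hγf⟩ := mem_leaderOrbit.1 hif
  have hlt : L.symm w < i := by
    rcases h with h | h
    · exact symm_lt_of_isActive hG hL hi hf hif (Or.inl rfl) hw h.1 h.2
    · exact symm_lt_of_isActive hG hL hi hf hif (Or.inr rfl) hw h.1 h.2
  have hγw : γ w = w := by simpa using hfix _ hlt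
  have hiff : G.Adj w f ↔ G.Adj w (L i) := by
    have := hγ.1 w (L i)
    rwa [hγw, hγf] at this
  have hcard : (closedNbhd G f).ncard = (closedNbhd G (L i)).ncard := by
    rw [← hγf, ncard_closedNbhd_apply hγ]
  have hadj : G.Adj w (L i) := by tauto
  have hle : (closedNbhd G (L i)).ncard ≤ (closedNbhd G w).ncard := by
    rcases h with h | h
    · exact h.2
    · rw [← hcard]; exact h.2
  have hlt' : (closedNbhd G (L i)).ncard < (closedNbhd G w).ncard := by
    -- Equal sizes would make `w` and the leader twins, and so the leader adjacent to `f`.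
    refine lt_of_le_of_ne hle fun heq => ?_
    have hmem : f ∈ closedNbhd G (L i) :=
      closedNbhd_subset hG hadj.symm heq.ge (Or.inr (hiff.2 hadj))
    exact not_sameOrbit_of_adj hG hi hf (hmem.resolve_left hne) (sameOrbit_of_mem_leaderOrbit hif)
  exact ⟨⟨hadj, hlt'⟩, hiff.2 hadj, hcard ▸ hlt'⟩

end Setup

/-! ### The signing and total unimodularity -/

/-- In increasing order the terms are -1, 1, -1, and so on, since each element counts itself. The
one-sided range lets two such sums be subtracted. -/
theorem sum_neg_one_pow_card_le {α β : Type*} [LinearOrder β] (r : α → β)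
    (hr : Function.Injective r) (s : Finset α) :
    ∑ v ∈ s, (-1 : ℤ) ^ (s.filter fun w => r w ≤ r v).card = if Even s.card then 0 else -1 := by
  classical
  induction s using Finset.induction_on_max_value r with
  | empty => simp
  | insert a s ha hmax ih =>
    have hlt : ∀ v ∈ s, r v < r a := fun v hv =>
      lt_of_le_of_ne (hmax v hv) (hr.ne (ne_of_mem_of_not_mem hv ha))
    have h1 : ∀ v ∈ s, ((insert a s).filter fun w => r w ≤ r v) =
        s.filter fun w => r w ≤ r v := fun v hv => by
      rw [Finset.filter_insert, if_neg (hlt v hv).not_ge]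
    have h2 : ((insert a s).filter fun w => r w ≤ r a) = insert a s := by
      refine Finset.filter_true_of_mem fun w hw => ?_
      rcases Finset.mem_insert.1 hw with rfl | hw
      · exact le_rfl
      · exact hmax w hw
    rw [Finset.sum_insert ha, h2, Finset.sum_congr rfl fun v hv => by rw [h1 v hv], ih,
      Finset.card_insert_of_notMem ha, pow_succ]
    rcases Nat.even_or_odd s.card with h | h
    · simp [h, h.neg_one_pow, Nat.even_add_one]
    · simp [Nat.not_even_iff_odd.2 h, h.neg_one_pow, Nat.even_add_one]

/-- Nodes ordered by decreasing size of the closed neighbourhood, ties being broken by position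
among the leaders. -/
noncomputable def rank (G : SimpleGraph V) (L : Fin (Fintype.card V) ≃ V) (v : V) :
    ℕᵒᵈ ×ₗ Fin (Fintype.card V) :=
  toLex (OrderDual.toDual (closedNbhd G v).ncard, L.symm v)

theorem rank_injective (G : SimpleGraph V) (L : Fin (Fintype.card V) ≃ V) :
    Function.Injective (rank G L) := fun _ _ h =>
  L.symm.injective (congrArg Prod.snd (toLex.injective h))

theorem ncard_le_of_rank_le {G : SimpleGraph V} {L : Fin (Fintype.card V) ≃ V} {w v : V}
    (h : rank G L w ≤ rank G L v) : (closedNbhd G v).ncard ≤ (closedNbhd G w).ncard := by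
  rcases Prod.Lex.toLex_le_toLex.1 h with h | h
  · exact (OrderDual.toDual_lt_toDual.1 h).le
  · exact (OrderDual.toDual.injective h.1).ge

theorem rank_le_of_ncard_lt {G : SimpleGraph V} {L : Fin (Fintype.card V) ≃ V} {w v : V}
    (h : (closedNbhd G v).ncard < (closedNbhd G w).ncard) : rank G L w ≤ rank G L v :=
  Prod.Lex.toLex_le_toLex.2 (Or.inl (OrderDual.toDual_lt_toDual.2 h))

/-- `w` is an ancestor of `v` (or `v` itself) in the rooted forest that represents the trivially
perfect graph `G`. -/
def IsAncestor (G : SimpleGraph V) (L : Fin (Fintype.card V) ≃ V) (w v : V) : Prop :=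
  (w = v ∨ G.Adj w v) ∧ rank G L w ≤ rank G L v

variable {G : SimpleGraph V} {c : V → ℤ} {L : Fin (Fintype.card V) ≃ V}

theorem mem_of_isAncestor (hG : IsTriviallyPerfect G) {C : Finset V}
    (hC : Maximal (fun D : Finset V => G.IsClique (D : Set V)) C) {w v : V} (hv : v ∈ C)
    (h : IsAncestor G L w v) : w ∈ C := by
  classical
  obtain ⟨rfl | hadj, hle⟩ := h
  · exact hv
  have hsub := closedNbhd_subset hG hadj (ncard_le_of_rank_le hle)
  -- The clique lies in the closed neighbourhood of `v`, hence in that of `w`, so maximality absorbs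
  -- `w`.
  refine hC.2 (y := insert w C) ?_ (Finset.subset_insert _ _) (Finset.mem_insert_self _ _)
  show G.IsClique (insert w C : Finset V)
  rw [Finset.coe_insert]
  refine SimpleGraph.IsClique.insert hC.1 fun z hz hne => ?_
  have hz' : z ∈ closedNbhd G v := by
    by_cases h : z = v
    · exact Or.inl h
    · exact Or.inr (hC.1 hv hz (Ne.symm h))
  exact (hsub hz').resolve_left hne.symm

open Classical in
/-- The alternating sum, along the nodes of a maximal clique, over the nodes satisfying `P`. -/
theorem sum_maxClique (hG : IsTriviallyPerfect G) {C : Finset V}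
    (hC : Maximal (fun D : Finset V => G.IsClique (D : Set V)) C) (T : Finset V) (P : V → Prop)
    [DecidablePred P] :
    (∑ v ∈ T.filter (fun v => v ∈ C ∧ P v),
      (-1 : ℤ) ^ (T.filter fun w => P w ∧ IsAncestor G L w v).card) = 0 ∨
    (∑ v ∈ T.filter (fun v => v ∈ C ∧ P v),
      (-1 : ℤ) ^ (T.filter fun w => P w ∧ IsAncestor G L w v).card) = -1 := by
  have h := sum_neg_one_pow_card_le (rank G L) (rank_injective G L)
    (T.filter fun v => v ∈ C ∧ P v)
  have h2 : ∀ v ∈ T.filter (fun v => v ∈ C ∧ P v),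
      (T.filter fun w => P w ∧ IsAncestor G L w v) =
        (T.filter fun v => v ∈ C ∧ P v).filter fun w => rank G L w ≤ rank G L v := by
    intro v hv
    have hvC := (Finset.mem_filter.1 hv).2.1
    ext w
    simp only [Finset.mem_filter]
    constructor
    · rintro ⟨hT, hP, hw⟩
      exact ⟨⟨hT, mem_of_isAncestor hG hC hvC hw, hP⟩, hw.2⟩
    · rintro ⟨⟨hT, hwC, hP⟩, hle⟩
      refine ⟨hT, hP, ?_, hle⟩
      by_cases h : w = v
      · exact Or.inl h
      · exact Or.inr (hC.1 hwC hvC h)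
  rw [Finset.sum_congr rfl fun v hv => by rw [h2 v hv], h]
  split_ifs <;> simp

open Classical in
/-- Signs that alternate along the active nodes and, with the opposite start, along the other
nodes. -/
noncomputable def sign (G : SimpleGraph V) (c : V → ℤ) (L : Fin (Fintype.card V) ≃ V)
    (T : Finset V) (v : V) : ℤ :=
  if IsActive G c L v then
    (-1) ^ (T.filter fun w => IsActive G c L w ∧ IsAncestor G L w v).card
  else -(-1) ^ (T.filter fun w => ¬ IsActive G c L w ∧ IsAncestor G L w v).card

theorem sign_eq_or (T : Finset V) (v : V) : sign G c L T v = 1 ∨ sign G c L T v = -1 := by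
  rw [sign]
  split_ifs
  · exact neg_one_pow_eq_or ℤ _
  · rw [neg_inj, neg_eq_iff_eq_neg]
    exact (neg_one_pow_eq_or ℤ _).symm

open Classical in
theorem abs_sum_sign_maxClique (hG : IsTriviallyPerfect G) {C : Finset V}
    (hC : Maximal (fun D : Finset V => G.IsClique (D : Set V)) C) (T : Finset V) :
    |∑ v ∈ T, (if v ∈ C then 1 else 0) * sign G c L T v| ≤ 1 := by
  have hsplit : ∑ v ∈ T, (if v ∈ C then 1 else 0) * sign G c L T v =
      (∑ v ∈ T.filter (fun v => v ∈ C ∧ IsActive G c L v),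
        (-1 : ℤ) ^ (T.filter fun w => IsActive G c L w ∧ IsAncestor G L w v).card) -
      ∑ v ∈ T.filter (fun v => v ∈ C ∧ ¬ IsActive G c L v),
        (-1 : ℤ) ^ (T.filter fun w => ¬ IsActive G c L w ∧ IsAncestor G L w v).card := by
    rw [Finset.sum_filter, Finset.sum_filter, ← Finset.sum_sub_distrib]
    refine Finset.sum_congr rfl fun v _ => ?_
    by_cases h1 : v ∈ C <;> by_cases h2 : IsActive G c L v <;> simp [h1, h2, sign]
  rw [hsplit]
  rcases sum_maxClique (L := L) hG hC T (IsActive G c L) with h1 | h1 <;>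
  rcases sum_maxClique (L := L) hG hC T (fun v => ¬ IsActive G c L v) with h2 | h2 <;>
  · rw [h1, h2]; simp

/-- Both ends have the same active proper ancestors in `T`, and each adds only itself to the count.
-/
theorem sign_eq_of_cut (hG : IsTriviallyPerfect G) (hL : IsStringent (weightAut G c) L)
    {i : Fin (Fintype.card V)} {f : V} (hi : L i ∉ deleted G (cuts (weightAut G c) L))
    (hf : f ∉ deleted G (cuts (weightAut G c) L)) (hif : f ∈ leaderOrbit (weightAut G c) L i)
    (hne : f ≠ L i) {T : Finset V} (hiT : L i ∈ T) (hfT : f ∈ T) :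
    sign G c L T (L i) = sign G c L T f := by
  classical
  have hai : IsActive G c L (L i) := ⟨i, f, hi, hf, hif, hne, Or.inl rfl⟩
  have haf : IsActive G c L f := ⟨i, f, hi, hf, hif, hne, Or.inr rfl⟩
  have hnadj : ¬ G.Adj (L i) f := fun h =>
    not_sameOrbit_of_adj hG hi hf h (sameOrbit_of_mem_leaderOrbit hif)
  have hself : ∀ v ∈ T, IsActive G c L v →
      (T.filter fun w => IsActive G c L w ∧ IsAncestor G L w v) =
        insert v (T.filter fun w => IsActive G c L w ∧ G.Adj w v ∧ rank G L w ≤ rank G L v) := by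
    intro v hv hav
    ext w
    rw [Finset.mem_filter, Finset.mem_insert, Finset.mem_filter, IsAncestor]
    constructor
    · rintro ⟨h1, h2, rfl | h3, h4⟩
      · exact Or.inl rfl
      · exact Or.inr ⟨h1, h2, h3, h4⟩
    · rintro (rfl | ⟨h1, h2, h3, h4⟩)
      · exact ⟨hv, hav, Or.inl rfl, le_rfl⟩
      · exact ⟨h1, h2, Or.inr h3, h4⟩
  have heq : (T.filter fun w => IsActive G c L w ∧ G.Adj w (L i) ∧ rank G L w ≤ rank G L (L i)) =
      T.filter fun w => IsActive G c L w ∧ G.Adj w f ∧ rank G L w ≤ rank G L f := by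
    refine Finset.filter_congr fun w _ => ?_
    refine and_congr_right fun hw => ⟨fun h => ?_, fun h => ?_⟩
    · obtain ⟨-, h1, h2⟩ :=
        adj_of_isActive hG hL hi hf hif hne hw (Or.inl ⟨h.1, ncard_le_of_rank_le h.2⟩)
      exact ⟨h1, rank_le_of_ncard_lt h2⟩
    · obtain ⟨⟨h1, h2⟩, -⟩ :=
        adj_of_isActive hG hL hi hf hif hne hw (Or.inr ⟨h.1, ncard_le_of_rank_le h.2⟩)
      exact ⟨h1, rank_le_of_ncard_lt h2⟩
  rw [sign, sign, if_pos hai, if_pos haf, hself _ hiT hai, hself _ hfT haf, heq,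
    Finset.card_insert_of_notMem (by simp [hnadj]), Finset.card_insert_of_notMem (by simp)]

theorem abs_sum_sign_cliqueCut (hG : IsTriviallyPerfect G) (hL : IsStringent (weightAut G c) L)
    {i : Fin (Fintype.card V)} {C : Finset V} (hCi : (C : Set V) ⊆ leaderOrbit (weightAut G c) L i)
    (hC : G.IsClique (C : Set V)) {T : Finset V}
    (hT : ∀ v ∈ T, v ∉ deleted G (cuts (weightAut G c) L)) [DecidableEq V] :
    |∑ v ∈ T, (-(if v = L i then 1 else 0) + (if v ∈ C then 1 else 0)) * sign G c L T v| ≤ 1 := by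
  have hone : ∀ v, |sign G c L T v| = 1 := fun v => by
    rcases sign_eq_or (G := G) (c := c) (L := L) T v with h | h <;> rw [h] <;> rfl
  have hsum : ∑ v ∈ T, (-(if v = L i then 1 else 0) + (if v ∈ C then 1 else 0)) *
      sign G c L T v = -(if L i ∈ T then sign G c L T (L i) else 0) +
        ∑ v ∈ T.filter (· ∈ C), sign G c L T v := by
    simp [add_mul, Finset.sum_add_distrib, Finset.sum_filter]
  rw [hsum]
  have hsub : ∀ u ∈ T.filter (· ∈ C), ∀ v ∈ T.filter (· ∈ C), u = v := by
    intro u hu v hv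
    rw [Finset.mem_filter] at hu hv
    by_contra hne
    exact not_sameOrbit_of_adj hG (hT u hu.1) (hT v hv.1) (hC hu.2 hv.2 hne)
      ((sameOrbit_of_mem_leaderOrbit (hCi hu.2)).symm.trans
        (sameOrbit_of_mem_leaderOrbit (hCi hv.2)))
  rcases (T.filter (· ∈ C)).eq_empty_or_nonempty with h | ⟨f, hf⟩
  · rw [h]
    split_ifs <;> simp [hone]
  · have h : T.filter (· ∈ C) = {f} :=
      Finset.eq_singleton_iff_unique_mem.2 ⟨hf, fun v hv => hsub v hv f hf⟩
    rw [h, Finset.sum_singleton]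
    rw [Finset.mem_filter] at hf
    split_ifs with hi
    · by_cases hne : f = L i
      · simp [hne]
      · rw [sign_eq_of_cut hG hL (hT _ hi) (hT _ hf.1) (hCi hf.2) hne hi hf.1]
        simp
    · simp [hone]

theorem extendedMatrix_isTotallyUnimodular [DecidableEq V] (hG : IsTriviallyPerfect G)
    (hL : IsStringent (weightAut G c) L) :
    (extendedMatrix G (weightAut G c) L).IsTotallyUnimodular := by
  refine Matrix.isTotallyUnimodular_of_signing _ fun S => ?_
  refine ⟨fun v => sign G c L (S.map (Function.Embedding.subtype _)) v.1,
    fun v => sign_eq_or _ _, fun p => ?_⟩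
  have hT : ∀ v ∈ S.map (Function.Embedding.subtype _),
      v ∉ deleted G (cuts (weightAut G c) L) := by
    intro v hv
    obtain ⟨w, -, rfl⟩ := Finset.mem_map.1 hv
    exact w.2
  rcases p with C | p
  · have := abs_sum_sign_maxClique (c := c) (L := L) hG C.2 (S.map (Function.Embedding.subtype _))
    rw [Finset.sum_map] at this
    refine (congrArg _ (Finset.sum_congr rfl fun v _ => ?_)).trans_le this
    by_cases hv : v.1 ∈ C.1 <;> simp [extendedMatrix, cliqueMatrix, hv]
  · have := abs_sum_sign_cliqueCut hG hL p.2.1 p.2.2 hT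
    rwa [Finset.sum_map] at this

end SST

/-! ### The 0/1 points of the system and the polytope -/

namespace SST

variable {V : Type*} {G : SimpleGraph V}

instance [Finite V] : Finite (MaxClique G) := inferInstanceAs (Finite (Subtype _))

theorem add_le_one_of_mem_stablePolytope {x : V → ℝ} (hx : x ∈ stablePolytope G) {u v : V}
    (h : G.Adj u v) : x u + x v ≤ 1 := by
  have hconv : Convex ℝ {x : V → ℝ | x u + x v ≤ 1} :=
    convex_halfSpace_le (f := fun x : V → ℝ => x u + x v)
      ⟨fun x y => by simp; ring, fun r x => by simp [mul_add]⟩ 1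
  exact convexHull_min (fun y hy => hy.2 u v h) hconv hx

theorem exists_maxClique_of_adj [Finite V] {u v : V} (h : G.Adj u v) :
    ∃ C : MaxClique G, u ∈ C.1 ∧ v ∈ C.1 := by
  classical
  have hcl : G.IsClique (({u, v} : Finset V) : Set V) := by
    simpa using fun _ => h
  obtain ⟨C, hle, hC⟩ :=
    (Set.toFinite {D : Finset V | G.IsClique (D : Set V)}).exists_le_maximal hcl
  exact ⟨⟨C, hC⟩, hle (by simp), hle (by simp)⟩

theorem sum_le_one_of_isClique {x : V → ℝ} (hx : ∀ v, x v = 0 ∨ x v = 1)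
    (hadj : ∀ u v, G.Adj u v → x u + x v ≤ 1) {C : Finset V} (hC : G.IsClique (C : Set V)) :
    ∑ v ∈ C, x v ≤ 1 ∧ ∀ l, (∀ f ∈ C, x f ≤ x l) → 0 ≤ x l → ∑ v ∈ C, x v ≤ x l := by
  classical
  have hcase : (∀ v ∈ C, x v = 0) ∨ ∃ f ∈ C, x f = 1 ∧ ∑ v ∈ C, x v = 1 := by
    by_cases h : ∀ v ∈ C, x v = 0
    · exact Or.inl h
    · push Not at h
      obtain ⟨f, hf, hxf⟩ := h
      have hf1 := (hx f).resolve_left hxf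
      refine Or.inr ⟨f, hf, hf1, ?_⟩
      rw [Finset.sum_eq_single_of_mem f hf, hf1]
      intro v hv hne
      refine (hx v).resolve_right fun h1 => ?_
      have := hadj _ _ (hC hv hf hne)
      linarith
  rcases hcase with h | ⟨f, hf, h1, h2⟩
  · rw [Finset.sum_eq_zero h]
    exact ⟨zero_le_one, fun l _ h0 => h0⟩
  · rw [h2]
    exact ⟨le_rfl, fun l hl _ => h1 ▸ hl f hf⟩

theorem eq_zero_of_mem_deleted {S : Set (V × V)} {x : V → ℝ} (hx : ∀ v, x v = 0 ∨ x v = 1)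
    (hadj : ∀ u v, G.Adj u v → x u + x v ≤ 1) (hS : x ∈ cutCone S) {v : V}
    (hv : v ∈ deleted G S) : x v = 0 := by
  obtain ⟨l, hl, h⟩ := hv
  refine (hx v).resolve_right fun h1 => ?_
  have h2 := hadj _ _ h
  have h3 : -x l + x v ≤ 0 := hS _ hl
  linarith

variable [Fintype V] {c : V → ℤ} {L : Fin (Fintype.card V) ≃ V}

instance (Γ : Subgroup (Equiv.Perm V)) : Finite (CliqueCut G Γ L) :=
  inferInstanceAs (Finite (Subtype _))

variable (G c L) in
/-- The system of box constraints, clique inequalities, SST clique cuts and deletions. -/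
def cliqueCutPolytope : Set (V → ℝ) :=
  {x | (∀ v, 0 ≤ x v ∧ x v ≤ 1) ∧
    (∀ C : MaxClique G, ∑ v ∈ C.1, x v ≤ 1) ∧
    (∀ p : CliqueCut G (weightAut G c) L, -x (L p.1.1) + ∑ f ∈ p.1.2, x f ≤ 0) ∧
    (∀ v ∈ deleted G (cuts (weightAut G c) L), x v = 0)}

theorem mem_cliqueCutPolytope_iff {x : V → ℝ} (hx : ∀ v, x v = 0 ∨ x v = 1) :
    x ∈ cliqueCutPolytope G c L ↔
      x ∈ stablePolytope G ∩ cutCone (cuts (weightAut G c) L) := by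
  constructor
  · rintro ⟨-, hclique, hcut, -⟩
    refine ⟨subset_convexHull ℝ _ ⟨hx, fun u v h => ?_⟩, ?_⟩
    · obtain ⟨C, hu, hv⟩ := exists_maxClique_of_adj h
      classical
      refine le_trans ?_ (hclique C)
      rw [← Finset.sum_pair h.ne]
      refine Finset.sum_le_sum_of_subset_of_nonneg ?_ fun w _ _ => ?_
      · simp [Finset.insert_subset_iff, hu, hv]
      · rcases hx w with h | h <;> simp [h]
    · rintro ⟨l, f⟩ ⟨i, hl, hf, -⟩
      simp only at hl hf ⊢
      subst hl
      -- An SST cut is the clique cut of a singleton.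
      simpa using hcut ⟨(i, {f}), by simpa using hf, by simp⟩
  · rintro ⟨hP, hS⟩
    have hadj : ∀ u v, G.Adj u v → x u + x v ≤ 1 := fun u v h =>
      add_le_one_of_mem_stablePolytope hP h
    have h0 : ∀ v, 0 ≤ x v := fun v => by rcases hx v with h | h <;> simp [h]
    refine ⟨fun v => ⟨h0 v, by rcases hx v with h | h <;> simp [h]⟩,
      fun C => (sum_le_one_of_isClique hx hadj C.2.1).1, ?_,
      fun v hv => eq_zero_of_mem_deleted hx hadj hS hv⟩
    rintro ⟨⟨i, C⟩, hCi, hC⟩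
    have := (sum_le_one_of_isClique hx hadj hC).2 (L i) (fun f hf => ?_) (h0 _)
    · simp only; linarith
    · by_cases hne : f = L i
      · rw [hne]
      · have : -x (L i) + x f ≤ 0 := hS (L i, f) ⟨i, rfl, hCi hf, hne⟩
        linarith

theorem cliqueCutPolytope_eq_cubePolytope [DecidableEq V] :
    cliqueCutPolytope G c L =
      cubePolytope (Matrix.fromRows (cliqueMatrix G) (cliqueCutMatrix G (weightAut G c) L))
        (Sum.elim (fun _ => 1) fun _ => 0) (deleted G (cuts (weightAut G c) L)) := by
  ext x
  simp [cliqueCutPolytope, cubePolytope, cliqueMatrix, cliqueCutMatrix, add_mul,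
    Finset.sum_add_distrib, and_assoc]

end SST

theorem theorem6 {V : Type*} [Fintype V] [DecidableEq V] (G : SimpleGraph V)
    (hG : SST.IsTriviallyPerfect G) (c : V → ℤ) (L : Fin (Fintype.card V) ≃ V)
    (hL : SST.IsStringent (SST.weightAut G c) L) :
    (SST.extendedMatrix G (SST.weightAut G c) L).IsTotallyUnimodular ∧
    SST.stablePolytopeCuts G (SST.cuts (SST.weightAut G c) L) =
      {x : V → ℝ |
        (∀ v, 0 ≤ x v ∧ x v ≤ 1) ∧
        (∀ C : SST.MaxClique G, ∑ v ∈ C.1, x v ≤ 1) ∧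
        (∀ p : SST.CliqueCut G (SST.weightAut G c) L, -x (L p.1.1) + ∑ f ∈ p.1.2, x f ≤ 0) ∧
        (∀ v ∈ SST.deleted G (SST.cuts (SST.weightAut G c) L), x v = 0)} := by
  have hTU := SST.extendedMatrix_isTotallyUnimodular hG hL
  refine ⟨hTU, ?_⟩
  change _ = SST.cliqueCutPolytope G c L
  have hset : {x : V → ℝ | (∀ v, x v = 0 ∨ x v = 1) ∧
      x ∈ SST.stablePolytope G ∩ SST.cutCone (SST.cuts (SST.weightAut G c) L)} =
      {x | (∀ v, x v = 0 ∨ x v = 1) ∧ x ∈ SST.cliqueCutPolytope G c L} :=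
    Set.ext fun x => and_congr_right fun hx => (SST.mem_cliqueCutPolytope_iff hx).symm
  rw [SST.stablePolytopeCuts, hset, SST.cliqueCutPolytope_eq_cubePolytope]
  exact convexHull_cubePolytope _ _ _ hTU
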